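/- Let $n,m\ge 0$ be integers, $A\in\mathbb{R}^{n\times n}$ and $B\in\mathbb{R}^{n\times m}$. Let $\mathcal{S}^k$ denote the space of real symmetric $k\times k$ matrices and $\mathcal{S}^k_+\subseteq\mathcal{S}^k$ the cone of positive semidefinite ones, and define the linear maps $E,L:\mathcal{S}^{n+m}\to\mathcal{S}^n$ by $$E(Q)=\begin{pmatrix} I & 0\end{pmatrix}Q\begin{pmatrix} I\\ 0\end{pmatrix},\qquad L(Q)=\begin{pmatrix} A & B\end{pmatrix}Q\begin{pmatrix} I\\ 0\end{pmatrix}+\begin{pmatrix} I & 0\end{pmatrix}Q\begin{pmatrix} A^T\\ B^T\end{pmatrix}.$$ Then the following are equivalent: (a) $(A,B)$ is controllable: for all $x_0,x_1\in\mathbb{R}^n$ there are $t_1\ge 0$, a piecewise continuous $u:[0,t_1]\to\mathbb{R}^m$ and a continuous $x:[0,t_1]\to\mathbb{R}^n$ with $\dot x=Ax+Bu$, $x(0)=x_0$ and $x(t_1)=x_1$; (b) $(E,L)$ is controllable on $\mathcal{S}^{n+m}_+$: for all $X_0,X_1\in E(\mathcal{S}^{n+m}_+)$ there are $t_1\ge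 0$ and a continuous $z:[0,t_1]\to\mathcal{S}^{n+m}_+$ with $\frac{d}{dt}E(z)=L(z)$, $E(z(0))=X_0$ and $E(z(t_1))=X_1$. Here the differential equations are understood in integrated form: $x(t)-x(s)=\int_s^t (Ax(\tau)+Bu(\tau))\,d\tau$ and $E(z(t))-E(z(s))=\int_s^t L(z(\tau))\,d\tau$ for all $s,t\in[0,t_1]$. -/

import Mathlib

open Set Filter Topology MeasureTheory
open scoped Matrix

-- Trace inner product norm on real matrices (only the usual topology matters in finite dimension).
attribute [local instance] Matrix.frobeniusNormedAddCommGroup Matrix.frobeniusNormedSpace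

noncomputable section

/-- `u` is piecewise continuous on `[a, b]`: it is continuous on `[a, b]` outside a finite set, and
at every point of `[a, b]` it has finite one-sided limits (from within `[a, b]`; at the end point `a`
the left-hand condition is void, and likewise at `b`). -/
def PiecewiseContinuousOnIcc {F : Type*} [TopologicalSpace F] (u : ℝ → F) (a b : ℝ) : Prop :=
  (∃ S : Set ℝ, S.Finite ∧ ∀ t ∈ Icc a b \ S, ContinuousWithinAt u (Icc a b) t) ∧
  ∀ t ∈ Icc a b,
    (∃ l, Tendsto u (𝓝[Icc a b ∩ Iio t] t) (𝓝 l)) ∧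
    (∃ r, Tendsto u (𝓝[Icc a b ∩ Ioi t] t) (𝓝 r))

/-- Controllability of the pair `(A, B)`: for all states `x₀`, `x₁` there are a finite time `t₁ ≥ 0`
and a piecewise continuous input `u` on `[0, t₁]` that steers a solution of `ẋ = A x + B u` from `x₀`
at time `0` to `x₁` at time `t₁`. The differential equation is read in integrated form. -/
def IsControllablePair {n m : ℕ} (A : Matrix (Fin n) (Fin n) ℝ) (B : Matrix (Fin n) (Fin m) ℝ) :
    Prop :=
  ∀ x₀ x₁ : Fin n → ℝ, ∃ t₁ : ℝ, 0 ≤ t₁ ∧ ∃ (x : ℝ → Fin n → ℝ) (u : ℝ → Fin m → ℝ),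
    ContinuousOn x (Icc 0 t₁) ∧ PiecewiseContinuousOnIcc u 0 t₁ ∧
    (∀ s ∈ Icc 0 t₁, ∀ t ∈ Icc 0 t₁, x t - x s = ∫ τ in s..t, (A *ᵥ x τ + B *ᵥ u τ)) ∧
    x 0 = x₀ ∧ x t₁ = x₁

/-- Controllability of a pair `E, L : Z → X` of bounded linear maps between finite-dimensional normed
spaces on a convex cone `K ⊆ Z`: any two points of `E(K)` are joined by a continuous trajectory
`z : [0, t₁] → K` of `d/dt E(z) = L(z)`. The differential equation is read in integrated form. -/
def IsControllableOn {Z X : Type*} [NormedAddCommGroup Z] [NormedSpace ℝ Z] [FiniteDimensional ℝ Z]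
    [NormedAddCommGroup X] [NormedSpace ℝ X] [FiniteDimensional ℝ X]
    (E L : Z →L[ℝ] X) (K : PointedCone ℝ Z) : Prop :=
  ∀ x₀ ∈ E '' (K : Set Z), ∀ x₁ ∈ E '' (K : Set Z), ∃ t₁ : ℝ, 0 ≤ t₁ ∧ ∃ z : ℝ → Z,
    ContinuousOn z (Icc 0 t₁) ∧ (∀ t ∈ Icc 0 t₁, z t ∈ K) ∧
    (∀ s ∈ Icc 0 t₁, ∀ t ∈ Icc 0 t₁, E (z t) - E (z s) = ∫ τ in s..t, L (z τ)) ∧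
    E (z 0) = x₀ ∧ E (z t₁) = x₁

/-- The space of real symmetric matrices with index set `ι`. -/
def SymMat (ι : Type*) : Submodule ℝ (Matrix ι ι ℝ) where
  carrier := {M | M.IsSymm}
  zero_mem' := Matrix.isSymm_zero
  add_mem' := fun h₁ h₂ => Matrix.IsSymm.add h₁ h₂
  smul_mem' := fun c _ h => Matrix.IsSymm.smul h c

/-- The cone of positive semidefinite matrices in the space of real symmetric matrices. -/
def psdCone (ι : Type*) [Fintype ι] : PointedCone ℝ (SymMat ι) where
  carrier := {Q | (Q : Matrix ι ι ℝ).PosSemidef}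
  zero_mem' := Matrix.PosSemidef.zero
  add_mem' := fun h₁ h₂ => Matrix.PosSemidef.add h₁ h₂
  smul_mem' := fun c _ h => Matrix.PosSemidef.smul h c.2

/-- The map `Q ↦ (I 0) Q (I 0)ᵀ` from symmetric matrices of size `n + m` to those of size `n`. -/
def inducedE (n m : ℕ) : SymMat (Fin n ⊕ Fin m) →L[ℝ] SymMat (Fin n) :=
  LinearMap.toContinuousLinearMap
    { toFun := fun Q =>
        ⟨Matrix.fromCols (1 : Matrix (Fin n) (Fin n) ℝ) (0 : Matrix (Fin n) (Fin m) ℝ) * Q.1 *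
            (Matrix.fromCols (1 : Matrix (Fin n) (Fin n) ℝ) (0 : Matrix (Fin n) (Fin m) ℝ))ᵀ, by
          have h : Q.1ᵀ = Q.1 := Q.2
          change _ᵀ = _
          simp only [Matrix.transpose_mul, Matrix.transpose_transpose, h, Matrix.mul_assoc]⟩
      map_add' := fun P Q => Subtype.ext (by
        simp [Matrix.mul_add, Matrix.add_mul])
      map_smul' := fun c Q => Subtype.ext (by
        simp) }

/-- The map `Q ↦ (A B) Q (I 0)ᵀ + (I 0) Q (A B)ᵀ` from symmetric matrices of size `n + m` to those
of size `n`. -/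
def inducedL {n m : ℕ} (A : Matrix (Fin n) (Fin n) ℝ) (B : Matrix (Fin n) (Fin m) ℝ) :
    SymMat (Fin n ⊕ Fin m) →L[ℝ] SymMat (Fin n) :=
  LinearMap.toContinuousLinearMap
    { toFun := fun Q =>
        ⟨Matrix.fromCols A B * Q.1 *
            (Matrix.fromCols (1 : Matrix (Fin n) (Fin n) ℝ) (0 : Matrix (Fin n) (Fin m) ℝ))ᵀ +
          Matrix.fromCols (1 : Matrix (Fin n) (Fin n) ℝ) (0 : Matrix (Fin n) (Fin m) ℝ) * Q.1 *
            (Matrix.fromCols A B)ᵀ, by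
          have h : Q.1ᵀ = Q.1 := Q.2
          change _ᵀ = _
          simp only [Matrix.transpose_add, Matrix.transpose_mul, Matrix.transpose_transpose, h,
            Matrix.mul_assoc]
          exact add_comm _ _⟩
      map_add' := fun P Q => Subtype.ext (by
        simp only [Submodule.coe_add, Matrix.mul_add, Matrix.add_mul]
        abel)
      map_smul' := fun c Q => Subtype.ext (by
        simp) }

end

/-! Both conditions are equivalent to `IsReachableBy A B T` for some `T > 0`. If it holds, the
Gramian over `[0, T]` is invertible and yields continuous inputs `U` steering `Φ' = A Φ + B U`
between any two matrices (`exists_steering`). A single column gives (a). For (b), factor the cone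
elements over the end points as `M Mᵀ`, steer between the upper blocks of the `M`s, and take `z =
(Φ; U)(Φ; U)ᵀ`: it is positive semidefinite, `E z = Φ Φᵀ`, and `L z` is the derivative of `Φ Φᵀ`.
Conversely, if `v exp(-τA) B = 0` on a long enough interval, then `v · exp(-τA) x` is conserved
along trajectories of (a), and the quadratic form of `exp(-τA) E(z) exp(-τA)ᵀ` at `v` along those of
(b). Steering each basis vector to `0`, respectively `0` to `I`, forces `v = 0`. -/

section MatrixCalculus

/-! ### Product rules for matrix-valued curves -/

theorem hasDerivAt_matrix {l k : Type*} [Fintype l] [Fintype k] {f : ℝ → Matrix l k ℝ} {f' : Matrix l k ℝ} {t : ℝ} :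
    HasDerivAt f f' t ↔ ∀ i j, HasDerivAt (fun s => f s i j) (f' i j) t := by
  have h : HasDerivAt f f' t ↔ HasDerivAt (F := l → k → ℝ) f f' t := Iff.rfl
  exact h.trans (hasDerivAt_pi.trans (forall_congr' fun _ => hasDerivAt_pi))

variable {l k p : Type*} [Fintype l] [Fintype k] [Fintype p]

theorem HasDerivAt.matrixMul {f : ℝ → Matrix l k ℝ} {g : ℝ → Matrix k p ℝ} {f' : Matrix l k ℝ}
    {g' : Matrix k p ℝ} {t : ℝ} (hf : HasDerivAt f f' t) (hg : HasDerivAt g g' t) :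
    HasDerivAt (fun s => f s * g s) (f' * g t + f t * g') t := by
  rw [hasDerivAt_matrix] at *
  intro i j
  simp only [Matrix.mul_apply, Matrix.add_apply, ← Finset.sum_add_distrib]
  exact HasDerivAt.fun_sum fun q _ => (hf i q).mul (hg q j)

theorem HasDerivAt.matrixTranspose {f : ℝ → Matrix l k ℝ} {f' : Matrix l k ℝ} {t : ℝ}
    (hf : HasDerivAt f f' t) : HasDerivAt (fun s => (f s)ᵀ) f'ᵀ t := by
  rw [hasDerivAt_matrix] at *
  exact fun i j => hf j i

theorem HasDerivAt.matrixMulVec {f : ℝ → Matrix l k ℝ} {g : ℝ → k → ℝ} {f' : Matrix l k ℝ}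
    {g' : k → ℝ} {t : ℝ} (hf : HasDerivAt f f' t) (hg : HasDerivAt g g' t) :
    HasDerivAt (fun s => f s *ᵥ g s) (f' *ᵥ g t + f t *ᵥ g') t := by
  rw [hasDerivAt_matrix] at hf
  rw [hasDerivAt_pi] at *
  intro i
  simp only [Matrix.mulVec, dotProduct, Pi.add_apply, ← Finset.sum_add_distrib]
  exact HasDerivAt.fun_sum fun q _ => (hf i q).mul (hg q)

theorem HasDerivAt.constDotProduct {g : ℝ → k → ℝ} {g' : k → ℝ} {t : ℝ} (v : k → ℝ)
    (hg : HasDerivAt g g' t) : HasDerivAt (fun s => v ⬝ᵥ g s) (v ⬝ᵥ g') t := by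
  rw [hasDerivAt_pi] at hg
  exact HasDerivAt.fun_sum fun q _ => (hg q).const_mul (v q)

end MatrixCalculus

/-- The flow `t ↦ exp (t A)` of a real square matrix. -/
noncomputable def matrixFlow {n : ℕ} (A : Matrix (Fin n) (Fin n) ℝ) (t : ℝ) :
    Matrix (Fin n) (Fin n) ℝ :=
  NormedSpace.exp (t • A)

/-! ### The matrix exponential flow -/

section Flow

variable {n : ℕ} (A : Matrix (Fin n) (Fin n) ℝ)

theorem matrixFlow_zero : matrixFlow A 0 = 1 := by
  simp [matrixFlow, NormedSpace.exp_zero]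

theorem matrixFlow_mul_neg (t : ℝ) : matrixFlow A t * matrixFlow (-A) t = 1 := by
  have h : Commute (t • A) (t • -A) := by
    simp [Commute, SemiconjBy]
  rw [matrixFlow, matrixFlow, ← Matrix.exp_add_of_commute _ _ h, smul_neg, add_neg_cancel,
    NormedSpace.exp_zero]

theorem matrixFlow_neg_mul (t : ℝ) : matrixFlow (-A) t * matrixFlow A t = 1 :=
  mul_eq_one_comm.mp (matrixFlow_mul_neg A t)

theorem hasDerivAt_matrixFlow (t : ℝ) :
    HasDerivAt (matrixFlow A) (A * matrixFlow A t) t := by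
  let : NormedRing (Matrix (Fin n) (Fin n) ℝ) := Matrix.frobeniusNormedRing
  let : NormedAlgebra ℝ (Matrix (Fin n) (Fin n) ℝ) := Matrix.frobeniusNormedAlgebra
  exact hasDerivAt_exp_smul_const' (𝕂 := ℝ) A t

theorem hasDerivAt_matrixFlow_comm (t : ℝ) :
    HasDerivAt (matrixFlow A) (matrixFlow A t * A) t := by
  let : NormedRing (Matrix (Fin n) (Fin n) ℝ) := Matrix.frobeniusNormedRing
  let : NormedAlgebra ℝ (Matrix (Fin n) (Fin n) ℝ) := Matrix.frobeniusNormedAlgebra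
  exact hasDerivAt_exp_smul_const (𝕂 := ℝ) A t

theorem continuous_matrixFlow : Continuous (matrixFlow A) :=
  continuous_iff_continuousAt.2 fun t => (hasDerivAt_matrixFlow A t).continuousAt

end Flow

/-! ### Differential equations in integrated form -/

section Integrated

variable {F : Type*} [NormedAddCommGroup F] [NormedSpace ℝ F] [CompleteSpace F]

theorem hasDerivAt_of_integral_eq {x w : ℝ → F} {T : ℝ} {S : Set ℝ} (hS : S.Finite)
    (hw : ContinuousOn w (Ioo 0 T \ S))
    (hx : ∀ s ∈ Icc 0 T, ∀ t ∈ Icc 0 T, x t - x s = ∫ τ in s..t, w τ)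
    {t : ℝ} (ht : t ∈ Ioo 0 T \ S) : HasDerivAt x (w t) t := by
  have ho : IsOpen (Ioo 0 T \ S) := isOpen_Ioo.sdiff hS.isClosed
  have h := intervalIntegral.integral_hasDerivAt_right
    (IntervalIntegrable.refl (f := w) (μ := volume) (a := t))
    (hw.stronglyMeasurableAtFilter ho t ht) (hw.continuousAt (ho.mem_nhds ht))
  refine (h.const_add (x t)).congr_of_eventuallyEq ?_
  filter_upwards [ho.mem_nhds ht] with s hs
  rw [← hx t (Ioo_subset_Icc_self ht.1) s (Ioo_subset_Icc_self hs.1)]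
  abel

theorem eq_of_hasDerivAt_zero_off_finite {f : ℝ → F} {T : ℝ} (hT : 0 ≤ T) {S : Set ℝ}
    (hS : S.Finite) (hf : ContinuousOn f (Icc 0 T))
    (hf' : ∀ t ∈ Ioo 0 T \ S, HasDerivAt f 0 t) : f T = f 0 := by
  have h := MeasureTheory.integral_eq_of_hasDerivAt_off_countable_of_le f (fun _ => (0 : F)) hT
    hS.countable hf hf' (by simp)
  rw [intervalIntegral.integral_zero] at h
  exact (sub_eq_zero.mp h.symm)

theorem hasDerivAt_integral_of_continuous {w : ℝ → F} (hw : Continuous w) (a t : ℝ) :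
    HasDerivAt (fun s => ∫ τ in a..s, w τ) (w t) t :=
  intervalIntegral.integral_hasDerivAt_right (hw.intervalIntegrable _ _)
    hw.aestronglyMeasurable.stronglyMeasurableAtFilter hw.continuousAt

theorem sub_eq_integral_of_hasDerivAt {x w : ℝ → F} (hx : ∀ t, HasDerivAt x (w t) t)
    (hw : Continuous w) (s t : ℝ) : x t - x s = ∫ τ in s..t, w τ :=
  (intervalIntegral.integral_eq_sub_of_hasDerivAt (fun τ _ => hx τ)
    (hw.intervalIntegrable s t)).symm

end Integrated

/-! ### The Gramian and controllability of the pair -/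

section Gramian

variable {n m : ℕ} (A : Matrix (Fin n) (Fin n) ℝ) (B : Matrix (Fin n) (Fin m) ℝ)

/-- No nonzero covector `v` satisfies `v exp(-τ A) B = 0` for all `τ ∈ [0, T]`. -/
def IsReachableBy (T : ℝ) : Prop :=
  ∀ v : Fin n → ℝ, (∀ τ ∈ Icc 0 T, v ᵥ* (matrixFlow (-A) τ * B) = 0) → v = 0

/-- The finite-horizon controllability Gramian. -/
noncomputable def gramian (t : ℝ) : Matrix (Fin n) (Fin n) ℝ :=
  ∫ τ in (0 : ℝ)..t, matrixFlow (-A) τ * B * (matrixFlow (-A) τ * B)ᵀ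

theorem continuous_gramian_integrand :
    Continuous fun τ => matrixFlow (-A) τ * B * (matrixFlow (-A) τ * B)ᵀ := by
  have h : Continuous fun τ => matrixFlow (-A) τ * B :=
    (continuous_matrixFlow (-A)).matrix_mul continuous_const
  exact h.matrix_mul h.matrix_transpose

theorem hasDerivAt_gramian (t : ℝ) :
    HasDerivAt (gramian A B) (matrixFlow (-A) t * B * (matrixFlow (-A) t * B)ᵀ) t :=
  hasDerivAt_integral_of_continuous (continuous_gramian_integrand A B) 0 t

theorem gramian_zero : gramian A B 0 = 0 := intervalIntegral.integral_same

variable {A B}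

/-- The quadratic form of the Gramian at `v` is the integral of `|v exp(-τA) B|²`. If `v` is in the
kernel, this continuous nonnegative integrand vanishes on `[0, T]`. -/
theorem IsReachableBy.isUnit_gramian {T : ℝ} (hT : 0 < T) (h : IsReachableBy A B T) :
    IsUnit (gramian A B T) := by
  rw [← Matrix.mulVec_injective_iff_isUnit]
  refine (injective_iff_map_eq_zero (gramian A B T).mulVecLin).2 fun v hv => h v ?_
  have hq : ∀ τ, v ⬝ᵥ ((matrixFlow (-A) τ * B * (matrixFlow (-A) τ * B)ᵀ) *ᵥ v) =
      (v ᵥ* (matrixFlow (-A) τ * B)) ⬝ᵥ (v ᵥ* (matrixFlow (-A) τ * B)) := fun τ => by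
    rw [← Matrix.mulVec_mulVec, Matrix.dotProduct_mulVec, Matrix.mulVec_transpose]
  have hd : ∀ t, HasDerivAt (fun s => v ⬝ᵥ (gramian A B s *ᵥ v))
      ((v ᵥ* (matrixFlow (-A) t * B)) ⬝ᵥ (v ᵥ* (matrixFlow (-A) t * B))) t := fun t => by
    have := ((hasDerivAt_gramian A B t).matrixMulVec (hasDerivAt_const t v)).constDotProduct v
    simpa only [Matrix.mulVec_zero, add_zero, hq] using this
  have hc : Continuous fun τ =>
      (v ᵥ* (matrixFlow (-A) τ * B)) ⬝ᵥ (v ᵥ* (matrixFlow (-A) τ * B)) := by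
    have : Continuous fun τ => v ᵥ* (matrixFlow (-A) τ * B) :=
      continuous_const.matrix_vecMul ((continuous_matrixFlow (-A)).matrix_mul continuous_const)
    exact this.dotProduct this
  have hint := sub_eq_integral_of_hasDerivAt hd hc 0 T
  have hv' : gramian A B T *ᵥ v = 0 := hv
  rw [hv', gramian_zero, Matrix.zero_mulVec, dotProduct_zero, sub_zero] at hint
  have hnn : ∀ x : Fin m → ℝ, 0 ≤ x ⬝ᵥ x := fun x =>
    Finset.sum_nonneg fun i _ => mul_self_nonneg (x i)
  by_contra! hne
  obtain ⟨τ, hτ, hne⟩ := hne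
  refine (intervalIntegral.integral_pos hT hc.continuousOn (fun x _ => ?_) ⟨τ, hτ, ?_⟩).ne hint
  · exact hnn _
  · exact lt_of_le_of_ne (hnn _)
      fun h0 => hne (dotProduct_self_eq_zero.mp h0.symm)

/-- Variation of constants with a Gramian input. Allowing several columns lets one statement serve
both vector states and factors of semidefinite matrices. -/
theorem IsReachableBy.exists_steering {T : ℝ} (hT : 0 < T) (h : IsReachableBy A B T)
    {ι : Type*} [Fintype ι] (Φ₀ Φ₁ : Matrix (Fin n) ι ℝ) :
    ∃ (Φ : ℝ → Matrix (Fin n) ι ℝ) (U : ℝ → Matrix (Fin m) ι ℝ), Continuous U ∧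
      (∀ t, HasDerivAt Φ (A * Φ t + B * U t) t) ∧ Φ 0 = Φ₀ ∧ Φ T = Φ₁ := by
  -- Chosen so that `Φ₀ + gramian A B T * C = exp(-TA) Φ₁`.
  set C := (gramian A B T)⁻¹ * (matrixFlow (-A) T * Φ₁ - Φ₀) with hC
  refine ⟨fun t => matrixFlow A t * (Φ₀ + gramian A B t * C),
    fun t => (matrixFlow (-A) t * B)ᵀ * C, ?_, fun t => ?_, ?_, ?_⟩
  · exact (((continuous_matrixFlow (-A)).matrix_mul
      continuous_const).matrix_transpose).matrix_mul continuous_const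
  · have hd := (hasDerivAt_matrixFlow A t).matrixMul
      (((hasDerivAt_gramian A B t).matrixMul (hasDerivAt_const t C)).const_add Φ₀)
    convert hd using 1
    have hc : matrixFlow A t * (matrixFlow (-A) t * B * (matrixFlow (-A) t * B)ᵀ * C) =
        (matrixFlow A t * matrixFlow (-A) t) * (B * ((matrixFlow (-A) t * B)ᵀ * C)) := by
      simp only [Matrix.mul_assoc]
    rw [Matrix.mul_zero, add_zero, hc, matrixFlow_mul_neg, Matrix.one_mul, Matrix.mul_assoc]
  · simp [matrixFlow_zero, gramian_zero]
  · have hu : IsUnit (gramian A B T).det :=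
      (Matrix.isUnit_iff_isUnit_det _).mp (h.isUnit_gramian hT)
    simp only [hC, Matrix.mul_nonsing_inv_cancel_left _ _ hu, add_sub_cancel]
    rw [← Matrix.mul_assoc, matrixFlow_mul_neg, Matrix.one_mul]

theorem Continuous.piecewiseContinuousOnIcc {F : Type*} [TopologicalSpace F] {u : ℝ → F}
    (hu : Continuous u) (a b : ℝ) : PiecewiseContinuousOnIcc u a b :=
  ⟨⟨∅, finite_empty, fun _ _ => hu.continuousWithinAt⟩, fun t _ =>
    ⟨⟨u t, hu.continuousWithinAt⟩, ⟨u t, hu.continuousWithinAt⟩⟩⟩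

theorem IsReachableBy.isControllablePair {T : ℝ} (hT : 0 < T) (h : IsReachableBy A B T) :
    IsControllablePair A B := fun x₀ x₁ => by
  obtain ⟨Φ, U, hU, hΦ, h0, h1⟩ := h.exists_steering hT
    (Matrix.replicateCol Unit x₀) (Matrix.replicateCol Unit x₁)
  have hx : ∀ t, HasDerivAt (fun s i => Φ s i ()) (A *ᵥ (fun i => Φ t i ()) +
      B *ᵥ (fun i => U t i ())) t := fun t =>
    hasDerivAt_pi.2 fun i => hasDerivAt_matrix.1 (hΦ t) i ()
  have hu : Continuous fun s i => U s i () :=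
    continuous_pi fun i => (hU.matrix_elem i ())
  have hc : Continuous fun s i => Φ s i () :=
    continuous_iff_continuousAt.2 fun t => (hx t).continuousAt
  refine ⟨T, hT.le, fun s i => Φ s i (), fun s i => U s i (), hc.continuousOn,
    hu.piecewiseContinuousOnIcc 0 T, fun s _ t _ => ?_, ?_, ?_⟩
  · exact sub_eq_integral_of_hasDerivAt hx ((continuous_const.matrix_mulVec hc).add
      (continuous_const.matrix_mulVec hu)) s t
  · simp [h0]
  · simp [h1]

theorem IsControllablePair.exists_isReachableBy (h : IsControllablePair A B) :
    ∃ T, 0 < T ∧ IsReachableBy A B T := by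
  -- Steer each basis vector to `0`: conservation of `v · exp(-τA) x` then reads `v i = 0`.
  choose t ht x u hx hu hint h0 h1 using fun i : Fin n => h (Pi.single i 1) 0
  -- One horizon beyond every `t i`; the `1` keeps it positive even if all of them vanish.
  refine ⟨1 + ∑ i, t i, add_pos_of_pos_of_nonneg one_pos (Finset.sum_nonneg fun i _ => ht i),
    fun v hv => funext fun i => ?_⟩
  have hti : t i ≤ 1 + ∑ j, t j :=
    (Finset.single_le_sum (fun j _ => ht j) (Finset.mem_univ i)).trans (by linarith)
  obtain ⟨S, hS, huS⟩ := (hu i).1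
  have hxat : ∀ τ ∈ Ioo 0 (t i) \ S, ContinuousAt (x i) τ := fun τ hτ =>
    (hx i).continuousAt (Icc_mem_nhds hτ.1.1 hτ.1.2)
  have huat : ∀ τ ∈ Ioo 0 (t i) \ S, ContinuousAt (u i) τ := fun τ hτ =>
    (huS τ ⟨Ioo_subset_Icc_self hτ.1, hτ.2⟩).continuousAt (Icc_mem_nhds hτ.1.1 hτ.1.2)
  have hw : ContinuousOn (fun τ => A *ᵥ x i τ + B *ᵥ u i τ) (Ioo 0 (t i) \ S) := by
    intro τ hτ
    exact (((Continuous.matrix_mulVec continuous_const continuous_id).continuousAt.comp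
      (hxat τ hτ)).add ((Continuous.matrix_mulVec continuous_const
        continuous_id).continuousAt.comp (huat τ hτ))).continuousWithinAt
  have hconst := eq_of_hasDerivAt_zero_off_finite
    (f := fun τ => v ⬝ᵥ (matrixFlow (-A) τ *ᵥ x i τ)) (ht i) hS ?_ fun τ hτ => ?_
  · simpa only [h0, h1, matrixFlow_zero, Matrix.one_mulVec, Matrix.mulVec_zero, dotProduct_zero,
      dotProduct_single, mul_one, Pi.zero_apply] using hconst.symm
  · refine (Continuous.dotProduct continuous_const continuous_id).comp_continuousOn
      ((Continuous.matrix_mulVec continuous_fst continuous_snd).comp_continuousOn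
        ((continuous_matrixFlow (-A)).continuousOn.prodMk (hx i)))
  · have hd := ((hasDerivAt_matrixFlow_comm (-A) τ).matrixMulVec
      (hasDerivAt_of_integral_eq hS hw (hint i) hτ)).constDotProduct v
    refine hd.congr_deriv ?_
    have hz := hv τ ⟨hτ.1.1.le, hτ.1.2.le.trans hti⟩
    rw [Matrix.mulVec_add, Matrix.mulVec_mulVec, Matrix.mulVec_mulVec, Matrix.mul_neg,
      Matrix.neg_mulVec, neg_add_cancel_left, Matrix.dotProduct_mulVec, hz, zero_dotProduct]

end Gramian

/-! ### The induced system on semidefinite matrices -/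

section Induced

variable {n m : ℕ} {A : Matrix (Fin n) (Fin n) ℝ} {B : Matrix (Fin n) (Fin m) ℝ}

/-- The symmetric matrix `M Mᵀ`. -/
def outerSquare {κ ι : Type*} [Fintype ι] (M : Matrix κ ι ℝ) : SymMat κ :=
  ⟨M * Mᵀ, by
    change _ᵀ = _
    rw [Matrix.transpose_mul, Matrix.transpose_transpose]⟩

theorem outerSquare_mem_psdCone {κ ι : Type*} [Fintype κ] [Fintype ι] (M : Matrix κ ι ℝ) :
    outerSquare M ∈ psdCone κ := by
  change (M * Mᵀ).PosSemidef
  simpa using Matrix.posSemidef_self_mul_conjTranspose M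

open scoped MatrixOrder in
theorem exists_eq_outerSquare {κ : Type*} [Fintype κ] {Q : SymMat κ} (hQ : Q ∈ psdCone κ) :
    ∃ M : Matrix κ κ ℝ, Q = outerSquare M := by
  classical
  have hQ' : (Q : Matrix κ κ ℝ).PosSemidef := hQ
  obtain ⟨M, hM⟩ := CStarAlgebra.nonneg_iff_eq_star_mul_self.mp hQ'.nonneg
  exact ⟨Mᵀ, Subtype.ext (by
    simpa [outerSquare, Matrix.star_eq_conjTranspose] using hM)⟩

theorem inducedE_outerSquare_fromRows {ι : Type*} [Fintype ι] (Φ : Matrix (Fin n) ι ℝ)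
    (U : Matrix (Fin m) ι ℝ) :
    inducedE n m (outerSquare (Matrix.fromRows Φ U)) = outerSquare Φ := by
  refine Subtype.ext ?_
  change Matrix.fromCols 1 0 * (Matrix.fromRows Φ U * (Matrix.fromRows Φ U)ᵀ) *
    (Matrix.fromCols 1 0)ᵀ = Φ * Φᵀ
  have h : Matrix.fromCols (1 : Matrix (Fin n) (Fin n) ℝ) (0 : Matrix (Fin n) (Fin m) ℝ) *
      Matrix.fromRows Φ U = Φ := by simp [Matrix.fromCols_mul_fromRows]
  rw [← Matrix.mul_assoc, h, Matrix.mul_assoc, ← Matrix.transpose_mul, h]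

theorem inducedE_outerSquare {ι : Type*} [Fintype ι] (M : Matrix (Fin n ⊕ Fin m) ι ℝ) :
    inducedE n m (outerSquare M) = outerSquare M.toRows₁ := by
  have h := inducedE_outerSquare_fromRows M.toRows₁ M.toRows₂
  rwa [Matrix.fromRows_toRows] at h

theorem inducedL_outerSquare_fromRows {ι : Type*} [Fintype ι] (Φ : Matrix (Fin n) ι ℝ)
    (U : Matrix (Fin m) ι ℝ) :
    (inducedL A B (outerSquare (Matrix.fromRows Φ U)) : Matrix (Fin n) (Fin n) ℝ) =
      (A * Φ + B * U) * Φᵀ + Φ * (A * Φ + B * U)ᵀ := by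
  change Matrix.fromCols A B * (Matrix.fromRows Φ U * (Matrix.fromRows Φ U)ᵀ) *
    (Matrix.fromCols 1 0)ᵀ + Matrix.fromCols 1 0 * (Matrix.fromRows Φ U *
      (Matrix.fromRows Φ U)ᵀ) * (Matrix.fromCols A B)ᵀ = _
  have h : Matrix.fromCols (1 : Matrix (Fin n) (Fin n) ℝ) (0 : Matrix (Fin n) (Fin m) ℝ) *
      Matrix.fromRows Φ U = Φ := by simp [Matrix.fromCols_mul_fromRows]
  rw [← Matrix.mul_assoc, ← Matrix.mul_assoc, h, Matrix.mul_assoc, ← Matrix.transpose_mul, h,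
    Matrix.mul_assoc Φ, ← Matrix.transpose_mul, Matrix.fromCols_mul_fromRows]

theorem IsReachableBy.isControllableOn {T : ℝ} (hT : 0 < T) (h : IsReachableBy A B T) :
    IsControllableOn (inducedE n m) (inducedL A B) (psdCone (Fin n ⊕ Fin m)) := by
  rintro _ ⟨Q₀, hQ₀, rfl⟩ _ ⟨Q₁, hQ₁, rfl⟩
  obtain ⟨M₀, rfl⟩ := exists_eq_outerSquare hQ₀
  obtain ⟨M₁, rfl⟩ := exists_eq_outerSquare hQ₁
  obtain ⟨Φ, U, hU, hΦ, h0, h1⟩ := h.exists_steering hT M₀.toRows₁ M₁.toRows₁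
  have hΦc : Continuous Φ := continuous_iff_continuousAt.2 fun t => (hΦ t).continuousAt
  have hz : Continuous fun t => outerSquare (Matrix.fromRows (Φ t) (U t)) := by
    have hr : Continuous fun t => Matrix.fromRows (Φ t) (U t) :=
      continuous_matrix fun i j => by
        rcases i with i | i
        · exact hΦc.matrix_elem i j
        · exact hU.matrix_elem i j
    exact Continuous.subtype_mk (hr.matrix_mul hr.matrix_transpose) _
  have hE : ∀ t, inducedE n m (outerSquare (Matrix.fromRows (Φ t) (U t))) =
      outerSquare (Φ t) := fun t => inducedE_outerSquare_fromRows _ _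
  have hLc : Continuous fun t => inducedL A B (outerSquare (Matrix.fromRows (Φ t) (U t))) :=
    (inducedL A B).continuous.comp hz
  refine ⟨T, hT.le, fun t => outerSquare (Matrix.fromRows (Φ t) (U t)), hz.continuousOn,
    fun t _ => outerSquare_mem_psdCone _, fun s _ t _ => Subtype.ext ?_, ?_, ?_⟩
  · refine (congrArg Subtype.val (congrArg₂ (· - ·) (hE t) (hE s))).trans ?_
    change Φ t * (Φ t)ᵀ - Φ s * (Φ s)ᵀ = _
    have hd : ∀ t, HasDerivAt (fun t => Φ t * (Φ t)ᵀ)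
        ((SymMat (Fin n)).subtypeL
          (inducedL A B (outerSquare (Matrix.fromRows (Φ t) (U t))))) t := fun t => by
      rw [Submodule.subtypeL_apply, inducedL_outerSquare_fromRows]
      exact (hΦ t).matrixMul (hΦ t).matrixTranspose
    refine (sub_eq_integral_of_hasDerivAt hd
      ((SymMat (Fin n)).subtypeL.continuous.comp hLc) s t).trans ?_
    -- The derivative was taken among all matrices; the inclusion of the symmetric ones commutes
    -- with the integral.
    exact (SymMat (Fin n)).subtypeL.intervalIntegral_comp_comm (hLc.intervalIntegrable s t)
  · exact (hE 0).trans ((congrArg outerSquare h0).trans (inducedE_outerSquare M₀).symm)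
  · exact (hE T).trans ((congrArg outerSquare h1).trans (inducedE_outerSquare M₁).symm)

/-- Isolates the part of `L` not determined by `E(Q)`: it carries a factor `B`, which an
annihilating covector kills after conjugation by the flow. -/
theorem inducedL_eq (Q : SymMat (Fin n ⊕ Fin m)) :
    (inducedL A B Q : Matrix (Fin n) (Fin n) ℝ) =
      A * (inducedE n m Q : Matrix (Fin n) (Fin n) ℝ) +
        (inducedE n m Q : Matrix (Fin n) (Fin n) ℝ) * Aᵀ +
        (B * Q.1.toBlocks₂₁ + (B * Q.1.toBlocks₂₁)ᵀ) := by
  have hQ : Q.1ᵀ = Q.1 := Q.2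
  obtain ⟨Q, hQs⟩ := Q
  change Matrix.fromCols A B * Q * (Matrix.fromCols 1 0)ᵀ +
    Matrix.fromCols 1 0 * Q * (Matrix.fromCols A B)ᵀ =
      A * (Matrix.fromCols 1 0 * Q * (Matrix.fromCols 1 0)ᵀ) +
      (Matrix.fromCols 1 0 * Q * (Matrix.fromCols 1 0)ᵀ) * Aᵀ +
      (B * Q.toBlocks₂₁ + (B * Q.toBlocks₂₁)ᵀ)
  change Qᵀ = Q at hQ
  have h12 : Q.toBlocks₂₁ᵀ = Q.toBlocks₁₂ := by
    ext i j
    exact congrFun (congrFun hQ (Sum.inl i)) (Sum.inr j)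
  rw [Matrix.transpose_mul, h12, ← Matrix.fromBlocks_toBlocks Q]
  simp only [Matrix.transpose_fromCols, Matrix.fromCols_mul_fromBlocks,
    Matrix.fromCols_mul_fromRows, Matrix.toBlocks_fromBlocks₁₂, Matrix.toBlocks_fromBlocks₂₁,
    Matrix.transpose_one, Matrix.transpose_zero, Matrix.one_mul, Matrix.mul_one, Matrix.zero_mul,
    Matrix.mul_zero, add_zero]
  abel

theorem inducedE_one_eq :
    (inducedE n m (outerSquare (1 : Matrix (Fin n ⊕ Fin m) (Fin n ⊕ Fin m) ℝ)) :
      Matrix (Fin n) (Fin n) ℝ) = 1 := by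
  rw [inducedE_outerSquare]
  ext i j
  simp [outerSquare, Matrix.mul_apply, Matrix.toRows₁, Matrix.one_apply]

theorem ContinuousOn.dotProduct_conj {κ : Type*} [Fintype κ] {N X : ℝ → Matrix κ κ ℝ} {s : Set ℝ}
    (hN : ContinuousOn N s) (hX : ContinuousOn X s) (v : κ → ℝ) :
    ContinuousOn (fun τ => v ⬝ᵥ ((N τ * X τ * (N τ)ᵀ) *ᵥ v)) s := by
  rw [continuousOn_iff_continuous_domRestrict] at *
  exact continuous_const.dotProduct
    (((hN.matrix_mul hX).matrix_mul hN.matrix_transpose).matrix_mulVec continuous_const)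

theorem HasDerivAt.coe_symMat {κ : Type*} [Fintype κ] {f : ℝ → SymMat κ} {f' : SymMat κ} {t : ℝ}
    (hf : HasDerivAt f f' t) :
    HasDerivAt (fun s => (f s : Matrix κ κ ℝ)) (f' : Matrix κ κ ℝ) t :=
  (SymMat κ).subtypeL.hasFDerivAt.comp_hasDerivAt t hf

theorem IsControllableOn.exists_isReachableBy
    (h : IsControllableOn (inducedE n m) (inducedL A B) (psdCone (Fin n ⊕ Fin m))) :
    ∃ T, 0 < T ∧ IsReachableBy A B T := by
  obtain ⟨t, ht, z, hz, -, hint, h0, h1⟩ := h 0 ⟨0, zero_mem _, map_zero _⟩ _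
    ⟨_, outerSquare_mem_psdCone (1 : Matrix (Fin n ⊕ Fin m) (Fin n ⊕ Fin m) ℝ), rfl⟩
  -- The steering time `t` may be `0`, whereas the horizon must be positive.
  refine ⟨t + 1, by linarith, fun v hv => ?_⟩
  set X : ℝ → Matrix (Fin n) (Fin n) ℝ := fun τ => (inducedE n m (z τ)).1 with hX
  have hXc : ContinuousOn X (Icc 0 t) :=
    (continuous_subtype_val.comp (inducedE n m).continuous).comp_continuousOn hz
  have hw : ContinuousOn (fun τ => inducedL A B (z τ)) (Ioo 0 t \ ∅) :=
    (inducedL A B).continuous.comp_continuousOn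
      (hz.mono (sdiff_subset.trans Ioo_subset_Icc_self))
  have hN := continuous_matrixFlow (-A)
  have hconst := eq_of_hasDerivAt_zero_off_finite
    (f := fun τ => v ⬝ᵥ ((matrixFlow (-A) τ * X τ * (matrixFlow (-A) τ)ᵀ) *ᵥ v)) ht finite_empty
    ?_ fun τ hτ => ?_
  · have hX0 : X 0 = 0 := congrArg Subtype.val h0
    have hXt : X t = 1 := (congrArg Subtype.val h1).trans inducedE_one_eq
    simp only [hX0, hXt, Matrix.mul_one, Matrix.mul_zero, Matrix.zero_mul, Matrix.zero_mulVec,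
      dotProduct_zero] at hconst
    -- At time `t` the state is `I`, so the conserved form is `|v exp(-tA)|² = 0`; invertibility of
    -- the flow gives `v = 0`.
    rw [← Matrix.mulVec_mulVec, Matrix.dotProduct_mulVec, Matrix.mulVec_transpose,
      dotProduct_self_eq_zero] at hconst
    have h2 := congrArg (· ᵥ* matrixFlow A t) hconst
    simpa [Matrix.vecMul_vecMul, matrixFlow_neg_mul] using h2
  · exact hN.continuousOn.dotProduct_conj hXc v
  · have hXd : HasDerivAt X (A * X τ + X τ * Aᵀ +
        (B * (z τ).1.toBlocks₂₁ + (B * (z τ).1.toBlocks₂₁)ᵀ)) τ := by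
      have hEd := (hasDerivAt_of_integral_eq finite_empty hw hint hτ).coe_symMat
      exact hEd.congr_deriv (inducedL_eq (z τ))
    have hNd := hasDerivAt_matrixFlow_comm (-A) τ
    have hd := (((hNd.matrixMul hXd).matrixMul hNd.matrixTranspose).matrixMulVec
      (hasDerivAt_const τ v)).constDotProduct v
    refine hd.congr_deriv ?_
    have hz' := hv τ ⟨hτ.1.1.le, by linarith [hτ.1.2]⟩
    generalize matrixFlow (-A) τ = N at hz' ⊢
    generalize X τ = Y
    generalize (z τ).1.toBlocks₂₁ = Z
    -- Conjugating by the flow cancels the drift terms in `A`; what remains is `N B Z Nᵀ` and its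
    -- transpose, both killed by `v N B = 0`.
    have hsum : (N * -A * Y + N * (A * Y + Y * Aᵀ + (B * Z + (B * Z)ᵀ))) * Nᵀ +
        N * Y * (N * -A)ᵀ = (N * B) * (Z * Nᵀ) + ((N * B) * (Z * Nᵀ))ᵀ := by
      simp only [Matrix.transpose_mul, Matrix.transpose_transpose, Matrix.transpose_neg,
        Matrix.mul_add, Matrix.add_mul, Matrix.mul_neg, Matrix.neg_mul, Matrix.mul_assoc]
      abel
    rw [hsum, Matrix.mulVec_zero, add_zero, Matrix.add_mulVec, dotProduct_add,
      Matrix.mulVec_transpose, dotProduct_comm v (v ᵥ* _), ← Matrix.dotProduct_mulVec,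
      ← Matrix.mulVec_mulVec, Matrix.dotProduct_mulVec, hz']
    simp

end Induced

theorem corollary3 (n m : ℕ) (A : Matrix (Fin n) (Fin n) ℝ) (B : Matrix (Fin n) (Fin m) ℝ) :
    IsControllablePair A B ↔
      IsControllableOn (inducedE n m) (inducedL A B) (psdCone (Fin n ⊕ Fin m)) := by
  constructor
  · intro h
    obtain ⟨T, hT, hr⟩ := h.exists_isReachableBy
    exact hr.isControllableOn hT
  · intro h
    obtain ⟨T, hT, hr⟩ := h.exists_isReachableBy
    exact hr.isControllablePair hT
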